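/- Let $-\infty\le a<b\le+\infty$ and let $W$ be a differentiable function on $(a,b)$ with values in the (Hermitian) positive definite $N\times N$ matrices, such that $\int_a^b |x|^k|W_{ij}(x)|\,dx<\infty$ and $\int_a^b|x|^k|W_{ij}'(x)|\,dx<\infty$ for all $i,j$ and all $k\ge 0$. For matrix polynomials put $(P,Q)_W=\int_a^b P(x)W(x)Q(x)^*\,dx$. Then there is a unique sequence $(\widehat P_n)_{n\ge0}$ of matrix polynomials, the monic MOPRL (matrix orthogonal polynomials on the real line), such that $\widehat P_n(x)=x^nI+\sum_{j<n}a_{n,j}x^j$ and $(\widehat P_n,Q)_W=0$ for every matrix polynomial $Q$ of degree less than $n$. Moreover there are matrices $\kappa_n$ with $(\kappa_n\widehat P_n,\kappa_m\widehat P_m)_W=\delta_{n,m}I$. For any such $\kappa_n$ put $\gamma_n=\kappa_n^*\kappa_n$, $\alpha_n=a_{n,n-1}-a_{n+1,n}$ and $\beta_n=\gamma_n^{-1}\gamma_{n-1}$, with the conventions $\widehat P_{-1}=0$, $\gamma_{-1}=0$, $a_{0,-1}=0$. Then, for all $n\ge 0$, $$x\widehat P_n(x)=\widehat P_{n+1}(x)+\alpha_n\widehat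 P_n(x)+\beta_n\widehat P_{n-1}(x).$$ For $z\in\mathbb C\setminus[a,b]$ let $$\mathfrak A_n(z)=-\gamma_n\left(\int_a^b\frac{\widehat P_n(t)W'(t)\widehat P_n^*(t)}{t-z}\,dt-\frac{\widehat P_n(t)W(t)\widehat P_n^*(t)}{t-z}\bigg|_{t=a}^{t=b}\right),$$ $$\mathfrak B_n(z)=-\left(\int_a^b\frac{\widehat P_n(t)W'(t)\widehat P_{n-1}^*(t)}{t-z}\,dt-\frac{\widehat P_n(t)W(t)\widehat P_{n-1}^*(t)}{t-z}\bigg|_{t=a}^{t=b}\right)\gamma_{n-1},$$ where the boundary values at $a$ and $b$ are one-sided limits (limits at $\mp\infty$ for infinite endpoints), and let $\mathfrak A_n^*(z)=(\mathfrak A_n(\bar z))^*$. Then, for every $n\ge0$ and every $z\in\mathbb C\setminus[a,b]$, these integrals converge absolutely, these limits exist, and the monic MOPRL satisfy the lowering relation $$\widehat P_n'(z)=-\mathfrak B_n(z)\widehat P_n(z)+\mathfrak A_n^*(z)\beta_n\widehat P_{n-1}(z)$$ and the raising relation $$\widehat P_n'(z)=\bigl[\mathfrak A_n^*(z)(zI-\alpha_n)-\mathfrak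 B_n(z)\bigr]\widehat P_n(z)-\mathfrak A_n^*(z)\widehat P_{n+1}(z).$$ -/

import Mathlib

open Polynomial MeasureTheory Filter Topology
open scoped ComplexOrder

namespace MOPRL

noncomputable section

/-- `N × N` complex matrices. -/
abbrev Mat (N : ℕ) : Type := Matrix (Fin N) (Fin N) ℂ

/-- The open interval `(a, b)` of the real line, with possibly infinite endpoints. -/
def openInterval (a b : EReal) : Set ℝ := {x | a < (x : EReal) ∧ (x : EReal) < b}

/-- The closed interval `[a, b]` (its finite points), seen inside the complex plane. -/
def closedInterval (a b : EReal) : Set ℂ :=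
  {z | ∃ x : ℝ, a ≤ (x : EReal) ∧ (x : EReal) ≤ b ∧ z = (x : ℂ)}

/-- The filter of real `t → a`, `t > a` (it is `t → -∞` when `a = ⊥`). -/
def leftEnd (a : EReal) : Filter ℝ := comap (fun t : ℝ => (t : EReal)) (𝓝[>] a)

/-- The filter of real `t → b`, `t < b` (it is `t → +∞` when `b = ⊤`). -/
def rightEnd (b : EReal) : Filter ℝ := comap (fun t : ℝ => (t : EReal)) (𝓝[<] b)

/-- Entrywise derivative of a matrix function of a real variable. -/
def entryDeriv {N : ℕ} (W : ℝ → Mat N) (x : ℝ) : Mat N :=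
  Matrix.of fun i j => deriv (fun t : ℝ => W t i j) x

/-- Entrywise integrability over `(a, b)`. -/
def EntryIntegrable {N : ℕ} (a b : EReal) (F : ℝ → Mat N) : Prop :=
  ∀ i j, IntegrableOn (fun t : ℝ => F t i j) (openInterval a b)

/-- Entrywise integral over `(a, b)`. -/
def entryIntegral {N : ℕ} (a b : EReal) (F : ℝ → Mat N) : Mat N :=
  Matrix.of fun i j => ∫ t in openInterval a b, F t i j

/-- A weight on the finite or infinite interval `(a, b)`: a differentiable function with values in
the (Hermitian) positive definite matrices, such that all moments of the entries of `W` and of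
`W'` are finite.  Values of `W` outside `(a, b)` play no role. -/
structure IsWeight {N : ℕ} (a b : EReal) (W : ℝ → Mat N) : Prop where
  lt : a < b
  posDef : ∀ x ∈ openInterval a b, (W x).PosDef
  differentiable : ∀ x ∈ openInterval a b, ∀ i j, DifferentiableAt ℝ (fun t : ℝ => W t i j) x
  moments : ∀ n : ℕ, EntryIntegrable a b fun x => (x : ℂ) ^ n • W x
  moments_deriv : ∀ n : ℕ, EntryIntegrable a b fun x => (x : ℂ) ^ n • entryDeriv W x

/-- The value `∑ₖ Aₖ zᵏ` of the matrix polynomial `∑ₖ Aₖ Xᵏ` at a complex number `z`. -/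
def value {N : ℕ} (P : (Mat N)[X]) (z : ℂ) : Mat N := P.eval (Matrix.scalar (Fin N) z)

/-- The matrix inner product `(P, Q)_W = ∫ P(x) W(x) Q(x)* dx`. -/
def pairing {N : ℕ} (a b : EReal) (W : ℝ → Mat N) (P Q : (Mat N)[X]) : Mat N :=
  entryIntegral a b fun x => value P x * W x * (value Q x).conjTranspose

/-- `P` is the sequence of monic orthogonal matrix polynomials: `P n` is monic of degree `n`, and
`(P n, Q)_W = 0` for each matrix polynomial `Q` of degree less than `n`. -/
structure IsMonicMOPRL {N : ℕ} (a b : EReal) (W : ℝ → Mat N) (P : ℕ → (Mat N)[X]) : Prop where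
  degree_le : ∀ n, (P n).degree ≤ n
  coeff_self : ∀ n, (P n).coeff n = 1
  orthogonal : ∀ (n : ℕ) (Q : (Mat N)[X]), Q.degree < n → pairing a b W (P n) Q = 0

/-- The polynomials `κₙ Pₙ` are orthonormal: `(κₙ Pₙ, κₘ Pₘ)_W = δₙₘ I`. -/
def IsNormalizing {N : ℕ} (a b : EReal) (W : ℝ → Mat N) (P : ℕ → (Mat N)[X])
    (κ : ℕ → Mat N) : Prop :=
  ∀ n m, pairing a b W (C (κ n) * P n) (C (κ m) * P m) = if n = m then 1 else 0

/-- The sequence `n ↦ f (n - 1)`, with the convention `f (-1) = 0`. -/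
def prev {R : Type*} [Zero R] (f : ℕ → R) : ℕ → R
  | 0 => 0
  | n + 1 => f n

/-- The subleading coefficient `a_{n,n-1}` of `P n` (which is `0` for `n = 0`). -/
def subleading {N : ℕ} (P : ℕ → (Mat N)[X]) : ℕ → Mat N :=
  prev fun n => (P (n + 1)).coeff n

/-- `γₙ = κₙ* κₙ`. -/
def gam {N : ℕ} (κ : ℕ → Mat N) (n : ℕ) : Mat N := (κ n).conjTranspose * κ n

/-- `αₙ = a_{n,n-1} - a_{n+1,n}`. -/
def alpha {N : ℕ} (P : ℕ → (Mat N)[X]) (n : ℕ) : Mat N := subleading P n - subleading P (n + 1)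

/-- `βₙ = γₙ⁻¹ γₙ₋₁`. -/
def beta {N : ℕ} (κ : ℕ → Mat N) (n : ℕ) : Mat N := (gam κ n)⁻¹ * prev (gam κ) n

/-- `t ↦ P(t) V(t) Q(t)* / (t - z)`. -/
def kernel {N : ℕ} (V : ℝ → Mat N) (P Q : (Mat N)[X]) (z : ℂ) (t : ℝ) : Mat N :=
  ((t : ℂ) - z)⁻¹ • (value P t * V t * (value Q t).conjTranspose)

/-- `∫ P(t) W'(t) Q(t)* / (t - z) dt - [P(t) W(t) Q(t)* / (t - z)]` with the bracket taken between
`t = a` and `t = b` in the sense of one-sided limits. -/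
def ladderTerm {N : ℕ} (a b : EReal) (W : ℝ → Mat N) (P Q : (Mat N)[X]) (z : ℂ) : Mat N :=
  entryIntegral a b (kernel (entryDeriv W) P Q z) -
    (limUnder (rightEnd b) (kernel W P Q z) - limUnder (leftEnd a) (kernel W P Q z))

/-- The integral and both boundary limits in `ladderTerm` exist. -/
def LadderTermExists {N : ℕ} (a b : EReal) (W : ℝ → Mat N) (P Q : (Mat N)[X]) (z : ℂ) : Prop :=
  EntryIntegrable a b (kernel (entryDeriv W) P Q z) ∧
    (∃ L, Tendsto (kernel W P Q z) (rightEnd b) (𝓝 L)) ∧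
    ∃ L, Tendsto (kernel W P Q z) (leftEnd a) (𝓝 L)

/-- The coefficient `𝔄ₙ(z)`. -/
def ladderA {N : ℕ} (a b : EReal) (W : ℝ → Mat N) (P : ℕ → (Mat N)[X]) (κ : ℕ → Mat N)
    (n : ℕ) (z : ℂ) : Mat N :=
  -(gam κ n * ladderTerm a b W (P n) (P n) z)

/-- The coefficient `𝔅ₙ(z)`. -/
def ladderB {N : ℕ} (a b : EReal) (W : ℝ → Mat N) (P : ℕ → (Mat N)[X]) (κ : ℕ → Mat N)
    (n : ℕ) (z : ℂ) : Mat N :=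
  -(ladderTerm a b W (P n) (prev P n) z * prev (gam κ) n)

/-- `F*(z) = (F(z̄))*`. -/
def starFun {N : ℕ} (F : ℂ → Mat N) (z : ℂ) : Mat N :=
  (F ((starRingEnd ℂ) z)).conjTranspose

end

end MOPRL

/-! Let `K = reproducing P κ z n` be the reproducing kernel of the polynomials of degree less than
`n`. Since `Pₙ'` has degree less than `n`, `Pₙ'(z) = (Pₙ', K)_W` (`pairing_reproducing`).
Integration by parts moves the derivative onto `W` and `K` and leaves boundary terms; the term with
`K'` vanishes because `Pₙ` is orthogonal to lower degrees. The Christoffel–Darboux formula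
(`sub_smul_reproducing`) writes `K(t)*` as `(t - z)⁻¹` times a combination of `Pₙ(t)*` and
`Pₙ₋₁(t)*`, which turns what remains into the two ladder integrals
(`pairing_derivative_eq_ladderTerm`). With `γₙ₋₁ = γₙ βₙ` this is the lowering relation; eliminating
`Pₙ₋₁` by the three-term recurrence gives the raising relation.

Convergence rests on one remark: off `[a, b]` the factor `(t - z)⁻¹` is bounded, so `P W Q* / (t -
z)` has an integrable derivative and hence limits at both ends. Existence, uniqueness and
normalization rest on the positivity of `(Q, Q)_W` (`dotProduct_pairing_pos`), which makes
orthogonal projection possible one degree at a time. -/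

namespace MOPRL

variable {N : ℕ} {a b : EReal}

/-! ### Values of matrix polynomials -/

@[simp]
theorem value_zero (z : ℂ) : value (0 : (Mat N)[X]) z = 0 := by simp [value]

@[simp]
theorem value_add (P Q : (Mat N)[X]) (z : ℂ) : value (P + Q) z = value P z + value Q z := by
  simp [value]

@[simp]
theorem value_sub (P Q : (Mat N)[X]) (z : ℂ) : value (P - Q) z = value P z - value Q z := by
  simp [value]

@[simp]
theorem value_C_mul (A : Mat N) (P : (Mat N)[X]) (z : ℂ) :
    value (C A * P) z = A * value P z := by
  simp [value]

@[simp]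
theorem value_X_mul (P : (Mat N)[X]) (z : ℂ) : value (X * P) z = z • value P z := by
  rw [X_mul, value, eval_mul_X, ← value, Matrix.scalar_apply, ← Matrix.smul_one_eq_diagonal,
    Matrix.mul_smul, mul_one]

theorem value_monomial (n : ℕ) (A : Mat N) (z : ℂ) : value (monomial n A) z = z ^ n • A := by
  rw [value, eval_monomial, ← map_pow, Matrix.scalar_apply, ← Matrix.smul_one_eq_diagonal,
    Matrix.mul_smul, mul_one]

theorem value_apply (P : (Mat N)[X]) (z : ℂ) (i j : Fin N) :
    value P z i j = (matPolyEquiv.symm P i j).eval z := by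
  rw [← matPolyEquiv_eval, AlgEquiv.apply_symm_apply, value]

theorem hasDerivAt_value (P : (Mat N)[X]) (x : ℝ) (i j : Fin N) :
    HasDerivAt (fun t : ℝ => value P t i j) (value (derivative P) x i j) x := by
  induction P using Polynomial.induction_on' with
  | add P Q hP hQ => simpa using! hP.add hQ
  | monomial n A =>
    simp only [value_monomial, derivative_monomial, Matrix.smul_apply, smul_eq_mul]
    -- The factor `n` produced by `derivative_monomial` is a matrix, namely the scalar matrix `n I`.
    have h : (A * (n : Mat N)) i j = n * A i j := by
      rw [← (Nat.cast_commute n A).eq, ← nsmul_eq_mul]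
      simp
    rw [h]
    have := ((Complex.ofRealCLM.hasDerivAt (x := x)).pow n).mul_const (A i j)
    refine this.congr_deriv ?_
    simp
    ring

/-! ### The interval and its end filters -/

theorem isOpen_openInterval (a b : EReal) : IsOpen (openInterval a b) :=
  isOpen_Ioo.preimage continuous_coe_real_ereal

theorem measurableSet_openInterval (a b : EReal) : MeasurableSet (openInterval a b) :=
  (isOpen_openInterval a b).measurableSet

theorem ordConnected_openInterval (a b : EReal) : (openInterval a b).OrdConnected :=
  ⟨fun _ hx _ hy _ hz => ⟨hx.1.trans_le (EReal.coe_le_coe_iff.2 hz.1),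
    (EReal.coe_le_coe_iff.2 hz.2).trans_lt hy.2⟩⟩

theorem openInterval_nonempty (h : a < b) : (openInterval a b).Nonempty := by
  obtain ⟨x, hx⟩ := EReal.lt_iff_exists_real_btwn.1 h
  exact ⟨x, hx⟩

theorem isClosed_closedInterval (a b : EReal) : IsClosed (closedInterval a b) := by
  have h : closedInterval a b = Complex.ofReal '' ((fun t : ℝ => (t : EReal)) ⁻¹' Set.Icc a b) := by
    ext z
    constructor
    · rintro ⟨x, h1, h2, rfl⟩
      exact ⟨x, ⟨h1, h2⟩, rfl⟩
    · rintro ⟨x, ⟨h1, h2⟩, rfl⟩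
      exact ⟨x, h1, h2, rfl⟩
  rw [h]
  exact Complex.isometry_ofReal.isClosedEmbedding.isClosedMap _
    (isClosed_Icc.preimage continuous_coe_real_ereal)

theorem coe_mem_closedInterval {x : ℝ} (hx : x ∈ openInterval a b) :
    (x : ℂ) ∈ closedInterval a b :=
  ⟨x, hx.1.le, hx.2.le, rfl⟩

theorem conj_notMem_closedInterval {z : ℂ} (hz : z ∉ closedInterval a b) :
    (starRingEnd ℂ) z ∉ closedInterval a b := by
  rintro ⟨x, h1, h2, h⟩
  refine hz ⟨x, h1, h2, ?_⟩
  rw [← Complex.conj_conj z, h, Complex.conj_ofReal]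

theorem sub_ne_zero_of_notMem {z : ℂ} (hz : z ∉ closedInterval a b) {x : ℝ}
    (hx : x ∈ openInterval a b) : (x : ℂ) - z ≠ 0 :=
  sub_ne_zero.2 fun h => hz (h ▸ coe_mem_closedInterval hx)

/-- A point outside a closed set has positive distance to it, also when the interval is unbounded.
-/
theorem exists_norm_inv_sub_le {z : ℂ} (hz : z ∉ closedInterval a b) :
    ∃ M : ℝ, ∀ x ∈ openInterval a b, ‖((x : ℂ) - z)⁻¹‖ ≤ M := by
  obtain ⟨ε, hε, h⟩ := Metric.isOpen_iff.1 (isClosed_closedInterval a b).isOpen_compl z hz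
  refine ⟨ε⁻¹, fun x hx => ?_⟩
  rw [norm_inv]
  refine inv_anti₀ hε (not_lt.1 fun hlt => h ?_ (coe_mem_closedInterval hx))
  rwa [Metric.mem_ball, dist_eq_norm]

instance (a : EReal) : (leftEnd a).IsCountablyGenerated := by
  unfold leftEnd nhdsWithin; infer_instance

instance (b : EReal) : (rightEnd b).IsCountablyGenerated := by
  unfold rightEnd nhdsWithin; infer_instance

theorem eventually_leftEnd_lt {x : ℝ} (hx : a < x) : ∀ᶠ t in leftEnd a, t < x := by
  filter_upwards [preimage_mem_comap (Ioo_mem_nhdsGT hx)] with t ht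
  exact EReal.coe_lt_coe_iff.1 ht.2

theorem eventually_rightEnd_gt {x : ℝ} (hx : (x : EReal) < b) : ∀ᶠ t in rightEnd b, x < t := by
  filter_upwards [preimage_mem_comap (Ioo_mem_nhdsLT hx)] with t ht
  exact EReal.coe_lt_coe_iff.1 ht.1

theorem eventually_leftEnd_mem (h : a < b) : ∀ᶠ t in leftEnd a, t ∈ openInterval a b :=
  preimage_mem_comap (Ioo_mem_nhdsGT h)

theorem eventually_rightEnd_mem (h : a < b) : ∀ᶠ t in rightEnd b, t ∈ openInterval a b :=
  preimage_mem_comap (Ioo_mem_nhdsLT h)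

theorem leftEnd_neBot (h : a < b) : (leftEnd a).NeBot := by
  refine comap_neBot fun s hs => ?_
  obtain ⟨c, hc, hs⟩ := (mem_nhdsGT_iff_exists_Ioo_subset' h).1 hs
  obtain ⟨x, hx⟩ := EReal.lt_iff_exists_real_btwn.1 hc
  exact ⟨x, hs hx⟩

theorem rightEnd_neBot (h : a < b) : (rightEnd b).NeBot := by
  refine comap_neBot fun s hs => ?_
  obtain ⟨c, hc, hs⟩ := (mem_nhdsLT_iff_exists_Ioo_subset' h).1 hs
  obtain ⟨x, hx⟩ := EReal.lt_iff_exists_real_btwn.1 hc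
  exact ⟨x, hs hx⟩

/-- The fundamental theorem of calculus on `(a, b)`, with limits at the ends. -/
theorem exists_tendsto_ends_of_hasDerivAt (hab : a < b) {f f' : ℝ → ℂ}
    (hf : ∀ x ∈ openInterval a b, HasDerivAt f (f' x) x)
    (hf' : IntegrableOn f' (openInterval a b)) :
    ∃ L R : ℂ, Tendsto f (leftEnd a) (𝓝 L) ∧ Tendsto f (rightEnd b) (𝓝 R) ∧
      ∫ x in openInterval a b, f' x = R - L := by
  obtain ⟨c, hc⟩ := openInterval_nonempty hab
  have hoc := ordConnected_openInterval a b
  have ftc : ∀ t ∈ openInterval a b, f t = f c + ∫ x in c..t, f' x := by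
    intro t ht
    have hsub : Set.uIcc c t ⊆ openInterval a b := hoc.uIcc_subset hc ht
    rw [intervalIntegral.integral_eq_sub_of_hasDerivAt (fun x hx => hf x (hsub hx))]
    · ring
    · exact (intervalIntegrable_iff).2 (hf'.mono_set (Set.uIoc_subset_uIcc.trans hsub))
  set S := openInterval a b
  have hS : MeasurableSet S := measurableSet_openInterval a b
  have hR : Tendsto (fun t => ∫ x in c..t, f' x) (rightEnd b)
      (𝓝 (∫ x in S ∩ Set.Ioi c, f' x)) := by
    -- The intervals `(c, t]` exhaust the part of `(a, b)` to the right of `c` as `t → b`, so their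
    -- integrals converge by integrability.
    have hcov : AECover (volume.restrict (S ∩ Set.Ioi c)) (rightEnd b) (fun t => Set.Ioc c t) :=
      { ae_eventually_mem := by
          filter_upwards [ae_restrict_mem (hS.inter measurableSet_Ioi)] with x hx
          filter_upwards [eventually_rightEnd_gt hx.1.2] with t ht
          exact ⟨hx.2, ht.le⟩
        measurableSet := fun _ => measurableSet_Ioc }
    refine (hcov.integral_tendsto_of_countably_generated
      (hf'.mono_set Set.inter_subset_left)).congr' ?_
    filter_upwards [eventually_rightEnd_gt hc.2, eventually_rightEnd_mem hab] with t h1 h2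
    rw [intervalIntegral.integral_of_le h1.le, Measure.restrict_restrict measurableSet_Ioc,
      Set.inter_eq_left.2]
    exact fun x hx => ⟨hoc.out hc h2 ⟨hx.1.le, hx.2⟩, hx.1⟩
  have hL : Tendsto (fun t => ∫ x in c..t, f' x) (leftEnd a)
      (𝓝 (-∫ x in S ∩ Set.Iic c, f' x)) := by
    have hcov : AECover (volume.restrict (S ∩ Set.Iic c)) (leftEnd a) (fun t => Set.Ioc t c) :=
      { ae_eventually_mem := by
          filter_upwards [ae_restrict_mem (hS.inter measurableSet_Iic)] with x hx
          filter_upwards [eventually_leftEnd_lt hx.1.1] with t ht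
          exact ⟨ht, hx.2⟩
        measurableSet := fun _ => measurableSet_Ioc }
    refine (hcov.integral_tendsto_of_countably_generated
      (hf'.mono_set Set.inter_subset_left)).neg.congr' ?_
    filter_upwards [eventually_leftEnd_lt hc.1, eventually_leftEnd_mem hab] with t h1 h2
    rw [intervalIntegral.integral_of_ge h1.le, Measure.restrict_restrict measurableSet_Ioc,
      Set.inter_eq_left.2]
    exact fun x hx => ⟨hoc.out h2 hc ⟨hx.1.le, hx.2⟩, hx.2⟩
  refine ⟨_, _, (hL.const_add (f c)).congr' ?_, (hR.const_add (f c)).congr' ?_, ?_⟩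
  · filter_upwards [eventually_leftEnd_mem hab] with t ht using (ftc t ht).symm
  · filter_upwards [eventually_rightEnd_mem hab] with t ht using (ftc t ht).symm
  · rw [← integral_inter_add_sdiff (measurableSet_Ioi (a := c)) hf', Set.sdiff_eq, Set.compl_Ioi]
    ring

/-! ### Entrywise integrals -/

section EntryIntegral

variable {F G : ℝ → Mat N}

theorem EntryIntegrable.add (hF : EntryIntegrable a b F) (hG : EntryIntegrable a b G) :
    EntryIntegrable a b fun t => F t + G t :=
  fun i j => (hF i j).add (hG i j)

theorem EntryIntegrable.sub (hF : EntryIntegrable a b F) (hG : EntryIntegrable a b G) :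
    EntryIntegrable a b fun t => F t - G t :=
  fun i j => (hF i j).sub (hG i j)

theorem EntryIntegrable.const_mul (A : Mat N) (hF : EntryIntegrable a b F) :
    EntryIntegrable a b fun t => A * F t := fun i j => by
  simp only [Matrix.mul_apply]
  exact integrable_finsetSum _ fun k _ => (hF k j).const_mul (A i k)

theorem EntryIntegrable.mul_const (A : Mat N) (hF : EntryIntegrable a b F) :
    EntryIntegrable a b fun t => F t * A := fun i j => by
  simp only [Matrix.mul_apply]
  exact integrable_finsetSum _ fun k _ => (hF i k).mul_const (A k j)

theorem EntryIntegrable.inv_sub_smul (hF : EntryIntegrable a b F) {z : ℂ}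
    (hz : z ∉ closedInterval a b) : EntryIntegrable a b fun t => ((t : ℂ) - z)⁻¹ • F t := by
  intro i j
  obtain ⟨M, hM⟩ := exists_norm_inv_sub_le hz
  refine Integrable.bdd_mul (c := M) (hF i j) (Measurable.aestronglyMeasurable (by fun_prop)) ?_
  filter_upwards [ae_restrict_mem (measurableSet_openInterval a b)] with x hx using hM x hx

theorem entryIntegral_congr (h : ∀ t ∈ openInterval a b, F t = G t) :
    entryIntegral a b F = entryIntegral a b G := by
  ext i j
  exact setIntegral_congr_fun (measurableSet_openInterval a b) fun t ht => by simp only [h t ht]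

theorem EntryIntegrable.congr (hF : EntryIntegrable a b F)
    (h : ∀ t ∈ openInterval a b, F t = G t) : EntryIntegrable a b G :=
  fun i j => (hF i j).congr_fun (fun t ht => by simp only [h t ht])
    (measurableSet_openInterval a b)

theorem entryIntegral_add (hF : EntryIntegrable a b F) (hG : EntryIntegrable a b G) :
    entryIntegral a b (fun t => F t + G t) = entryIntegral a b F + entryIntegral a b G := by
  ext i j
  exact integral_add (hF i j) (hG i j)

theorem entryIntegral_sub (hF : EntryIntegrable a b F) (hG : EntryIntegrable a b G) :
    entryIntegral a b (fun t => F t - G t) = entryIntegral a b F - entryIntegral a b G := by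
  ext i j
  exact integral_sub (hF i j) (hG i j)

theorem entryIntegral_const_mul (A : Mat N) (hF : EntryIntegrable a b F) :
    entryIntegral a b (fun t => A * F t) = A * entryIntegral a b F := by
  ext i j
  simp only [entryIntegral, Matrix.of_apply, Matrix.mul_apply]
  rw [integral_finsetSum _ fun k _ => (hF k j).const_mul (A i k)]
  simp only [integral_const_mul]

theorem entryIntegral_mul_const (A : Mat N) (hF : EntryIntegrable a b F) :
    entryIntegral a b (fun t => F t * A) = entryIntegral a b F * A := by
  ext i j
  simp only [entryIntegral, Matrix.of_apply, Matrix.mul_apply]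
  rw [integral_finsetSum _ fun k _ => (hF i k).mul_const (A k j)]
  simp only [integral_mul_const]

theorem entryIntegral_conjTranspose (F : ℝ → Mat N) :
    entryIntegral a b (fun t => (F t).conjTranspose) = (entryIntegral a b F).conjTranspose := by
  ext i j
  exact integral_conj

/-- All polynomial moments of `V` are finite, so `P V Q*` is integrable. -/
theorem entryIntegrable_of_moments {V : ℝ → Mat N}
    (hV : ∀ n : ℕ, EntryIntegrable a b fun x => (x : ℂ) ^ n • V x) (P Q : (Mat N)[X]) :
    EntryIntegrable a b fun x => value P x * V x * (value Q x).conjTranspose := by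
  induction P using Polynomial.induction_on' with
  | add P P' hP hP' => simpa only [value_add, Matrix.add_mul] using hP.add hP'
  | monomial n A =>
    induction Q using Polynomial.induction_on' with
    | add Q Q' hQ hQ' =>
      simpa only [value_add, Matrix.conjTranspose_add, Matrix.mul_add] using hQ.add hQ'
    | monomial m B =>
      refine (((hV (n + m)).const_mul A).mul_const B.conjTranspose).congr fun x _ => ?_
      simp [value_monomial, pow_add, smul_smul, mul_comm]

end EntryIntegral

/-! ### The matrix inner product -/

section Pairing

variable {W : ℝ → Mat N}

theorem IsWeight.integrable (hW : IsWeight a b W) (P Q : (Mat N)[X]) :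
    EntryIntegrable a b fun x => value P x * W x * (value Q x).conjTranspose :=
  entryIntegrable_of_moments hW.moments P Q

theorem pairing_add_left (hW : IsWeight a b W) (P P' Q : (Mat N)[X]) :
    pairing a b W (P + P') Q = pairing a b W P Q + pairing a b W P' Q := by
  simp only [pairing, value_add, Matrix.add_mul]
  exact entryIntegral_add (hW.integrable P Q) (hW.integrable P' Q)

theorem pairing_sub_left (hW : IsWeight a b W) (P P' Q : (Mat N)[X]) :
    pairing a b W (P - P') Q = pairing a b W P Q - pairing a b W P' Q := by
  simp only [pairing, value_sub, Matrix.sub_mul]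
  exact entryIntegral_sub (hW.integrable P Q) (hW.integrable P' Q)

theorem pairing_C_mul_left (hW : IsWeight a b W) (A : Mat N) (P Q : (Mat N)[X]) :
    pairing a b W (C A * P) Q = A * pairing a b W P Q := by
  simp only [pairing, value_C_mul, Matrix.mul_assoc]
  exact entryIntegral_const_mul A (by simpa only [Matrix.mul_assoc] using hW.integrable P Q)

/-- Multiplication by `x` is self-adjoint because `x` is real on the interval of integration. -/
theorem pairing_X_mul (P Q : (Mat N)[X]) :
    pairing a b W (X * P) Q = pairing a b W P (X * Q) := by
  simp only [pairing, value_X_mul, Matrix.conjTranspose_smul, Matrix.smul_mul, Matrix.mul_smul,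
    RCLike.star_def, Complex.conj_ofReal]

theorem pairing_conjTranspose (hW : IsWeight a b W) (P Q : (Mat N)[X]) :
    (pairing a b W P Q).conjTranspose = pairing a b W Q P := by
  rw [pairing, ← entryIntegral_conjTranspose]
  refine entryIntegral_congr fun t ht => ?_
  rw [Matrix.conjTranspose_mul, Matrix.conjTranspose_mul, Matrix.conjTranspose_conjTranspose,
    (hW.posDef t ht).isHermitian.eq, Matrix.mul_assoc]

theorem pairing_add_right (hW : IsWeight a b W) (P Q Q' : (Mat N)[X]) :
    pairing a b W P (Q + Q') = pairing a b W P Q + pairing a b W P Q' := by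
  rw [← pairing_conjTranspose hW, pairing_add_left hW, Matrix.conjTranspose_add,
    pairing_conjTranspose hW, pairing_conjTranspose hW]

theorem pairing_C_mul_right (hW : IsWeight a b W) (A : Mat N) (P Q : (Mat N)[X]) :
    pairing a b W P (C A * Q) = pairing a b W P Q * A.conjTranspose := by
  rw [← pairing_conjTranspose hW, pairing_C_mul_left hW, Matrix.conjTranspose_mul,
    pairing_conjTranspose hW]

theorem pairing_zero_right (P : (Mat N)[X]) : pairing a b W P 0 = 0 := by
  ext i j
  simp [pairing, entryIntegral]

open Matrix in
theorem dotProduct_pairing_mulVec (hW : IsWeight a b W) (Q : (Mat N)[X]) (v : Fin N → ℂ) :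
    IntegrableOn (fun x : ℝ => star ((value Q x)ᴴ *ᵥ v) ⬝ᵥ (W x *ᵥ ((value Q x)ᴴ *ᵥ v)))
      (openInterval a b) ∧
    star v ⬝ᵥ (pairing a b W Q Q *ᵥ v) = ∫ x : ℝ in openInterval a b,
      star ((value Q x)ᴴ *ᵥ v) ⬝ᵥ (W x *ᵥ ((value Q x)ᴴ *ᵥ v)) := by
  have h : ∀ M : Mat N, ∀ V : Mat N, star (Mᴴ *ᵥ v) ⬝ᵥ (V *ᵥ (Mᴴ *ᵥ v)) =
      ∑ i, ∑ j, star v i * ((M * V * Mᴴ) i j * v j) := by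
    intro M V
    rw [star_mulVec, conjTranspose_conjTranspose, ← dotProduct_mulVec, mulVec_mulVec,
      mulVec_mulVec]
    simp only [dotProduct, mulVec, Finset.mul_sum]
  have hint := hW.integrable Q Q
  have hterm : ∀ i j, IntegrableOn (fun x : ℝ => star v i *
      ((value Q x * W x * (value Q x)ᴴ) i j * v j)) (openInterval a b) :=
    fun i j => ((hint i j).mul_const (v j)).const_mul _
  simp only [h]
  refine ⟨integrable_finsetSum _ fun i _ => integrable_finsetSum _ fun j _ => hterm i j, ?_⟩
  rw [integral_finsetSum _ fun i _ => integrable_finsetSum _ fun j _ => hterm i j]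
  simp only [dotProduct, mulVec, Finset.mul_sum]
  refine Finset.sum_congr rfl fun i _ => ?_
  rw [integral_finsetSum _ fun j _ => hterm i j]
  refine Finset.sum_congr rfl fun j _ => ?_
  rw [integral_const_mul, integral_mul_const]
  rfl

open Matrix in
/-- `(Q, Q)_W` is positive on each vector `v` with `v* Q ≠ 0`. -/
theorem dotProduct_pairing_pos (hW : IsWeight a b W) (Q : (Mat N)[X]) (v : Fin N → ℂ) (k : ℕ)
    (hv : star v ᵥ* Q.coeff k ≠ 0) : 0 < star v ⬝ᵥ (pairing a b W Q Q *ᵥ v) := by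
  obtain ⟨hint, heq⟩ := dotProduct_pairing_mulVec hW Q v
  rw [heq]
  set f : ℝ → ℂ := fun x => star ((value Q x)ᴴ *ᵥ v) ⬝ᵥ (W x *ᵥ ((value Q x)ᴴ *ᵥ v)) with hf
  have hnonneg : ∀ x ∈ openInterval a b, 0 ≤ f x := fun x hx =>
    (hW.posDef x hx).posSemidef.dotProduct_mulVec_nonneg _
  obtain ⟨j, hj⟩ := Function.ne_iff.1 hv
  -- `p` is the `j`-th entry of the row `v* Q`; its `k`-th coefficient is nonzero, so it has
  -- finitely many roots, and the integrand is positive off them.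
  set p : ℂ[X] := ∑ i, C (star v i) * matPolyEquiv.symm Q i j with hp
  have hp0 : p ≠ 0 := by
    intro h
    refine hj ?_
    have := congrArg (fun q : ℂ[X] => q.coeff k) h
    simpa [hp, finsetSum_coeff, matPolyEquiv_symm_apply_coeff, vecMul, dotProduct] using this
  have hpos : ∀ x ∈ openInterval a b, p.eval (x : ℂ) ≠ 0 → 0 < f x := by
    intro x hx hpx
    refine (hW.posDef x hx).dotProduct_mulVec_pos fun h0 => hpx ?_
    have := congrFun (congrArg star h0) j
    rw [star_mulVec, conjTranspose_conjTranspose] at this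
    simpa [hp, eval_finsetSum, value_apply, vecMul, dotProduct] using this
  have hre : ∫ x in openInterval a b, f x = ((∫ x in openInterval a b, (f x).re : ℝ) : ℂ) := by
    rw [← integral_complex_ofReal]
    refine setIntegral_congr_fun (measurableSet_openInterval a b) fun x hx => ?_
    exact Complex.eq_re_of_ofReal_le (r := 0) (by simpa using hnonneg x hx)
  rw [hre, Complex.zero_lt_real]
  refine (integral_pos_iff_support_of_nonneg_ae ?_ hint.re).2 ?_
  · filter_upwards [ae_restrict_mem (measurableSet_openInterval a b)] with x hx
    exact (Complex.nonneg_iff.1 (hnonneg x hx)).1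
  · have hfin : {x : ℝ | p.eval (x : ℂ) = 0}.Finite :=
      (p.finite_setOfPred_isRoot hp0).preimage Complex.ofReal_injective.injOn
    have hsub : openInterval a b \ {x : ℝ | p.eval (x : ℂ) = 0} ⊆
        Function.support (fun x => (f x).re) := fun x hx =>
      ((Complex.pos_iff.1 (hpos x hx.1 hx.2)).1).ne'
    refine lt_of_lt_of_le ?_ (measure_mono hsub)
    rw [measure_sdiff_null (hfin.measure_zero _), Measure.restrict_apply_self]
    exact (isOpen_openInterval a b).measure_pos _ (openInterval_nonempty hW.lt)

theorem pairing_self_posDef (hW : IsWeight a b W) {Q : (Mat N)[X]} {n : ℕ}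
    (hQ : Q.coeff n = 1) : (pairing a b W Q Q).PosDef := by
  refine Matrix.PosDef.of_dotProduct_mulVec_pos (pairing_conjTranspose hW Q Q) fun v hv => ?_
  exact dotProduct_pairing_pos hW Q v n (by simpa [hQ] using hv)

/-- The basis vector `eᵢ` detects row `i` of each coefficient of `Q`. -/
theorem eq_zero_of_pairing_self_eq_zero (hW : IsWeight a b W) {Q : (Mat N)[X]}
    (hQ : pairing a b W Q Q = 0) : Q = 0 := by
  ext k i j
  by_contra h
  have := dotProduct_pairing_pos hW Q (Pi.single i 1) k fun h0 => h ?_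
  · simp [hQ] at this
  · simpa [← Pi.single_star] using congrFun h0 j

end Pairing

/-! ### Boundary values and integration by parts -/

section Kernel

variable {V W : ℝ → Mat N}

theorem kernel_integrable
    (hV : ∀ n : ℕ, EntryIntegrable a b fun x => (x : ℂ) ^ n • V x) (P Q : (Mat N)[X]) {z : ℂ}
    (hz : z ∉ closedInterval a b) : EntryIntegrable a b (kernel V P Q z) :=
  (entryIntegrable_of_moments hV P Q).inv_sub_smul hz

theorem IsWeight.hasDerivAt (hW : IsWeight a b W) {x : ℝ} (hx : x ∈ openInterval a b)
    (i j : Fin N) : HasDerivAt (fun t => W t i j) (entryDeriv W x i j) x :=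
  (hW.differentiable x hx i j).hasDerivAt

theorem HasDerivAt.matrix_mul {F G : ℝ → Mat N} {F' G' : Mat N} {x : ℝ}
    (hF : ∀ i j, HasDerivAt (fun t => F t i j) (F' i j) x)
    (hG : ∀ i j, HasDerivAt (fun t => G t i j) (G' i j) x) (i j : Fin N) :
    HasDerivAt (fun t => (F t * G t) i j) ((F' * G x + F x * G') i j) x := by
  simp only [Matrix.mul_apply, Matrix.add_apply, ← Finset.sum_add_distrib]
  exact HasDerivAt.fun_sum fun k _ => (hF i k).mul (hG k j)

/-- The derivative of `P W Q*`. -/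
noncomputable def sandwichDeriv (W : ℝ → Mat N) (P Q : (Mat N)[X]) (x : ℝ) : Mat N :=
  value (derivative P) x * W x * (value Q x).conjTranspose +
      value P x * entryDeriv W x * (value Q x).conjTranspose +
    value P x * W x * (value (derivative Q) x).conjTranspose

theorem hasDerivAt_sandwich (hW : IsWeight a b W) (P Q : (Mat N)[X]) {x : ℝ}
    (hx : x ∈ openInterval a b) (i j : Fin N) :
    HasDerivAt (fun t : ℝ => (value P t * W t * (value Q t).conjTranspose) i j)
      (sandwichDeriv W P Q x i j) x := by
  rw [sandwichDeriv, ← Matrix.add_mul]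
  exact HasDerivAt.matrix_mul
    (HasDerivAt.matrix_mul (hasDerivAt_value P x) fun i j => hW.hasDerivAt hx i j)
    (fun i j => (hasDerivAt_value Q x j i).star) i j

theorem sandwichDeriv_integrable (hW : IsWeight a b W) (P Q : (Mat N)[X]) :
    EntryIntegrable a b (sandwichDeriv W P Q) :=
  ((hW.integrable _ _).add (entryIntegrable_of_moments hW.moments_deriv _ _)).add
    (hW.integrable _ _)

theorem exists_tendsto_ends_of_entries (hab : a < b) {F F' : ℝ → Mat N}
    (hF : ∀ x ∈ openInterval a b, ∀ i j, HasDerivAt (fun t => F t i j) (F' x i j) x)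
    (hF' : EntryIntegrable a b F') :
    ∃ L R : Mat N, Tendsto F (leftEnd a) (𝓝 L) ∧ Tendsto F (rightEnd b) (𝓝 R) ∧
      entryIntegral a b F' = R - L := by
  choose L R hL hR h using fun i j =>
    exists_tendsto_ends_of_hasDerivAt hab (fun x hx => hF x hx i j) (hF' i j)
  refine ⟨Matrix.of L, Matrix.of R, tendsto_pi_nhds.2 fun i => tendsto_pi_nhds.2 (hL i),
    tendsto_pi_nhds.2 fun i => tendsto_pi_nhds.2 (hR i), ?_⟩
  ext i j
  exact h i j

/-- The derivative of the kernel involves only `(t - z)⁻¹`, `(t - z)⁻²` and products with finite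
moments, so it is integrable. -/
theorem kernel_tendsto_ends (hW : IsWeight a b W) (P Q : (Mat N)[X]) {z : ℂ}
    (hz : z ∉ closedInterval a b) :
    ∃ L R : Mat N, Tendsto (kernel W P Q z) (leftEnd a) (𝓝 L) ∧
      Tendsto (kernel W P Q z) (rightEnd b) (𝓝 R) := by
  have hint : EntryIntegrable a b fun t : ℝ =>
      ((t : ℂ) - z)⁻¹ • sandwichDeriv W P Q t - ((t : ℂ) - z)⁻¹ • (((t : ℂ) - z)⁻¹ •
        (value P t * W t * (value Q t).conjTranspose)) :=
    ((sandwichDeriv_integrable hW P Q).inv_sub_smul hz).sub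
      (((hW.integrable P Q).inv_sub_smul hz).inv_sub_smul hz)
  have hderiv := fun x (hx : x ∈ openInterval a b) i j =>
    (((Complex.ofRealCLM.hasDerivAt (x := x)).sub_const z).fun_inv
      (sub_ne_zero_of_notMem hz hx)).mul (hasDerivAt_sandwich hW P Q hx i j)
  obtain ⟨L, R, hL, hR, -⟩ := exists_tendsto_ends_of_entries (F := kernel W P Q z) hW.lt
    (fun x hx i j => (hderiv x hx i j).congr_deriv (by
      simp only [Matrix.sub_apply, Matrix.smul_apply, smul_eq_mul, Complex.ofRealCLM_apply,
        Complex.ofReal_one, div_eq_mul_inv, ← inv_pow]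
      ring)) hint
  exact ⟨L, R, hL, hR⟩

theorem ladderTermExists (hW : IsWeight a b W) (P Q : (Mat N)[X]) {z : ℂ}
    (hz : z ∉ closedInterval a b) : LadderTermExists a b W P Q z := by
  obtain ⟨L, R, hL, hR⟩ := kernel_tendsto_ends hW P Q hz
  exact ⟨kernel_integrable hW.moments_deriv P Q hz, ⟨R, hR⟩, ⟨L, hL⟩⟩

theorem ladderTerm_eq (hab : a < b) {P Q : (Mat N)[X]} {z : ℂ} {L R : Mat N}
    (hL : Tendsto (kernel W P Q z) (leftEnd a) (𝓝 L))
    (hR : Tendsto (kernel W P Q z) (rightEnd b) (𝓝 R)) :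
    ladderTerm a b W P Q z = entryIntegral a b (kernel (entryDeriv W) P Q z) - (R - L) := by
  have := leftEnd_neBot hab
  have := rightEnd_neBot hab
  rw [ladderTerm, hL.limUnder_eq, hR.limUnder_eq]

/-- `W` is Hermitian on a whole neighbourhood of `x`, so the identity `W* = W` can be
differentiated. -/
theorem entryDeriv_isHermitian (hW : IsWeight a b W) {x : ℝ} (hx : x ∈ openInterval a b) :
    (entryDeriv W x).conjTranspose = entryDeriv W x := by
  ext i j
  refine ((hW.hasDerivAt hx j i).star.congr_of_eventuallyEq ?_).unique (hW.hasDerivAt hx i j)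
  filter_upwards [(isOpen_openInterval a b).mem_nhds hx] with t ht
  exact ((hW.posDef t ht).isHermitian.apply i j).symm

theorem kernel_conjTranspose {t : ℝ} (hV : (V t).conjTranspose = V t) (P Q : (Mat N)[X]) (z : ℂ) :
    (kernel V P Q z t).conjTranspose = kernel V Q P ((starRingEnd ℂ) z) t := by
  simp [kernel, hV, Matrix.mul_assoc]

theorem ladderTerm_conjTranspose (hW : IsWeight a b W) (P Q : (Mat N)[X]) {z : ℂ}
    (hz : z ∉ closedInterval a b) :
    (ladderTerm a b W P Q ((starRingEnd ℂ) z)).conjTranspose = ladderTerm a b W Q P z := by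
  obtain ⟨L, R, hL, hR⟩ := kernel_tendsto_ends hW P Q (conj_notMem_closedInterval hz)
  have key : ∀ t ∈ openInterval a b,
      (kernel W P Q ((starRingEnd ℂ) z) t).conjTranspose = kernel W Q P z t := fun t ht => by
    rw [kernel_conjTranspose (hW.posDef t ht).isHermitian.eq, Complex.conj_conj]
  have hL' : Tendsto (kernel W Q P z) (leftEnd a) (𝓝 L.conjTranspose) := by
    refine ((continuous_id.matrix_conjTranspose.tendsto L).comp hL).congr' ?_
    filter_upwards [eventually_leftEnd_mem hW.lt] with t ht using key t ht
  have hR' : Tendsto (kernel W Q P z) (rightEnd b) (𝓝 R.conjTranspose) := by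
    refine ((continuous_id.matrix_conjTranspose.tendsto R).comp hR).congr' ?_
    filter_upwards [eventually_rightEnd_mem hW.lt] with t ht using key t ht
  rw [ladderTerm_eq hW.lt hL hR, ladderTerm_eq hW.lt hL' hR', Matrix.conjTranspose_sub,
    Matrix.conjTranspose_sub, ← entryIntegral_conjTranspose]
  congr 1
  refine entryIntegral_congr fun t ht => ?_
  rw [kernel_conjTranspose (entryDeriv_isHermitian hW ht), Complex.conj_conj]

/-- Integration by parts: if `Q'` is orthogonal to `P` and `(t - z) Q(t)*` is the combination
`P₁(t)* A₁ - P₂(t)* A₂`, then `(P', Q)` is given by the terms `ladderTerm`. -/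
theorem pairing_derivative_eq_ladderTerm (hW : IsWeight a b W) {P Q P₁ P₂ : (Mat N)[X]}
    {A₁ A₂ : Mat N} {z : ℂ} (hz : z ∉ closedInterval a b)
    (horth : pairing a b W P (derivative Q) = 0)
    (hQ : ∀ t : ℝ, ((t : ℂ) - z) • (value Q t).conjTranspose =
      (value P₁ t).conjTranspose * A₁ - (value P₂ t).conjTranspose * A₂) :
    pairing a b W (derivative P) Q =
      ladderTerm a b W P P₂ z * A₂ - ladderTerm a b W P P₁ z * A₁ := by
  -- This is `hQ` divided by `t - z`. It serves with `V = W` for the boundary values and with `V =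
  -- W'` for the integral.
  have key : ∀ V : ℝ → Mat N, ∀ t ∈ openInterval a b,
      kernel V P P₁ z t * A₁ - kernel V P P₂ z t * A₂ =
        value P t * V t * (value Q t).conjTranspose := by
    intro V t ht
    rw [← inv_smul_smul₀ (sub_ne_zero_of_notMem hz ht) (value Q t).conjTranspose, hQ t]
    simp only [kernel, Matrix.mul_smul, Matrix.smul_mul, Matrix.mul_sub, smul_sub,
      Matrix.mul_assoc]
  obtain ⟨L, R, hL, hR, hLR⟩ := exists_tendsto_ends_of_entries hW.lt
    (fun x hx i j => hasDerivAt_sandwich hW P Q hx i j) (sandwichDeriv_integrable hW P Q)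
  obtain ⟨L₁, R₁, hL₁, hR₁⟩ := kernel_tendsto_ends hW P P₁ hz
  obtain ⟨L₂, R₂, hL₂, hR₂⟩ := kernel_tendsto_ends hW P P₂ hz
  have := leftEnd_neBot hW.lt
  have := rightEnd_neBot hW.lt
  have eL : L = L₁ * A₁ - L₂ * A₂ := by
    refine tendsto_nhds_unique hL (((hL₁.mul_const A₁).sub (hL₂.mul_const A₂)).congr' ?_)
    filter_upwards [eventually_leftEnd_mem hW.lt] with t ht using key W t ht
  have eR : R = R₁ * A₁ - R₂ * A₂ := by
    refine tendsto_nhds_unique hR (((hR₁.mul_const A₁).sub (hR₂.mul_const A₂)).congr' ?_)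
    filter_upwards [eventually_rightEnd_mem hW.lt] with t ht using key W t ht
  have hd := entryIntegrable_of_moments hW.moments_deriv P Q
  have h1 : entryIntegral a b (sandwichDeriv W P Q) = pairing a b W (derivative P) Q +
      entryIntegral a b (fun t => value P t * entryDeriv W t * (value Q t).conjTranspose) := by
    unfold sandwichDeriv
    rw [entryIntegral_add ((hW.integrable _ _).add hd) (hW.integrable _ _),
      entryIntegral_add (hW.integrable _ _) hd]
    change _ + _ + pairing a b W P (derivative Q) = _
    rw [horth, add_zero]
    rfl
  have hk := fun P' => kernel_integrable hW.moments_deriv P P' hz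
  have h2 : entryIntegral a b (fun t => value P t * entryDeriv W t * (value Q t).conjTranspose) =
      entryIntegral a b (kernel (entryDeriv W) P P₁ z) * A₁ -
        entryIntegral a b (kernel (entryDeriv W) P P₂ z) * A₂ := by
    rw [← entryIntegral_congr (key (entryDeriv W)),
      entryIntegral_sub ((hk P₁).mul_const A₁) ((hk P₂).mul_const A₂),
      entryIntegral_mul_const _ (hk P₁), entryIntegral_mul_const _ (hk P₂)]
  rw [ladderTerm_eq hW.lt hL₁ hR₁, ladderTerm_eq hW.lt hL₂ hR₂,
    eq_sub_of_add_eq (h1.symm.trans hLR), h2, eL, eR]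
  noncomm_ring

end Kernel

/-! ### Existence and uniqueness of the monic orthogonal polynomials -/

section Orthogonal

variable {W : ℝ → Mat N}

theorem degree_sub_C_mul_lt {n : ℕ} {R p : (Mat N)[X]} (hR : R.degree < (n + 1 : ℕ))
    (hp : p.degree ≤ n) (hpn : p.coeff n = 1) : (R - C (R.coeff n) * p).degree < n := by
  rw [degree_lt_iff_coeff_zero] at hR ⊢
  intro m hm
  rcases hm.eq_or_lt with rfl | hm
  · simp [hpn]
  · have := coeff_eq_zero_of_degree_lt (hp.trans_lt (Nat.cast_lt.2 hm))
    simp [hR m hm, this]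

/-- The degree-lowering step of the inductions below: orthogonality handles `R'`, leaving only the
multiple of `p`. -/
theorem exists_eq_add_C_mul {n : ℕ} {R p : (Mat N)[X]} (hR : R.degree < (n + 1 : ℕ))
    (hp : p.degree ≤ n) (hpn : p.coeff n = 1) :
    ∃ R' : (Mat N)[X], R'.degree < n ∧ R = R' + C (R.coeff n) * p :=
  ⟨_, degree_sub_C_mul_lt hR hp hpn, (sub_add_cancel _ _).symm⟩

theorem degree_C_mul_le (A : Mat N) (P : (Mat N)[X]) : (C A * P).degree ≤ P.degree := by
  rw [← smul_eq_C_mul]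
  exact degree_smul_le A P

theorem degree_add_lt {P Q : (Mat N)[X]} {n : ℕ} (hP : P.degree < n) (hQ : Q.degree < n) :
    (P + Q).degree < n :=
  (degree_add_le P Q).trans_lt (max_lt hP hQ)

theorem degree_sub_lt_of_lt {P Q : (Mat N)[X]} {n : ℕ} (hP : P.degree < n) (hQ : Q.degree < n) :
    (P - Q).degree < n :=
  (degree_sub_le P Q).trans_lt (max_lt hP hQ)

theorem degree_lt_succ_of_le {P : (Mat N)[X]} {n : ℕ} (hP : P.degree ≤ n) :
    P.degree < (n + 1 : ℕ) :=
  hP.trans_lt (Nat.cast_lt.2 n.lt_succ_self)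

/-- Orthogonal projection onto the polynomials of degree less than `n`. -/
theorem exists_projection (hW : IsWeight a b W) (n : ℕ) (R : (Mat N)[X]) :
    ∃ S : (Mat N)[X], S.degree < n ∧
      ∀ Q : (Mat N)[X], Q.degree < n → pairing a b W (R - S) Q = 0 := by
  induction n generalizing R with
  | zero =>
    refine ⟨0, by simp, fun Q hQ => ?_⟩
    have : Q = 0 := by simpa using hQ
    rw [this, pairing_zero_right]
  | succ n ih =>
    obtain ⟨T, hT, hTo⟩ := ih (X ^ n)
    obtain ⟨S, hS, hSo⟩ := ih R
    -- The monic orthogonal polynomial of degree `n`, from the induction hypothesis applied to `X ^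
    -- n`.
    set p := X ^ n - T
    have hpn : p.coeff n = 1 := by
      simp [p, coeff_eq_zero_of_degree_lt hT]
    have hp : p.degree ≤ n :=
      (degree_sub_le _ _).trans (max_le (degree_X_pow_le n) hT.le)
    have hunit : IsUnit (pairing a b W p p).det :=
      (Matrix.isUnit_iff_isUnit_det _).1 (pairing_self_posDef hW hpn).isUnit
    -- The coefficient that makes `R - S - c p` orthogonal to `p`; the inverse stands on the right
    -- because the pairing is left-linear.
    set c := pairing a b W (R - S) p * (pairing a b W p p)⁻¹
    refine ⟨S + C c * p, degree_add_lt (hS.trans (Nat.cast_lt.2 n.lt_succ_self))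
      (degree_lt_succ_of_le ((degree_C_mul_le c p).trans hp)), fun Q hQ => ?_⟩
    obtain ⟨Q', hQ', hQe⟩ := exists_eq_add_C_mul hQ hp hpn
    rw [hQe, ← sub_sub, pairing_sub_left hW, pairing_C_mul_left hW, pairing_add_right hW,
      pairing_add_right hW, hSo Q' hQ', hTo Q' hQ', pairing_C_mul_right hW, pairing_C_mul_right hW,
      zero_add, zero_add, ← Matrix.mul_assoc, Matrix.mul_assoc _ _ (pairing a b W p p),
      Matrix.nonsing_inv_mul _ hunit, Matrix.mul_one, sub_self]

theorem eq_zero_of_orthogonal (hW : IsWeight a b W) {n : ℕ} {R : (Mat N)[X]} (hR : R.degree < n)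
    (h : ∀ Q : (Mat N)[X], Q.degree < n → pairing a b W R Q = 0) : R = 0 :=
  eq_zero_of_pairing_self_eq_zero hW (h R hR)

theorem existsUnique_isMonicMOPRL (hW : IsWeight a b W) :
    ∃! P : ℕ → (Mat N)[X], IsMonicMOPRL a b W P := by
  choose S hS hSo using fun n : ℕ => exists_projection hW n (X ^ n)
  refine ⟨fun n => X ^ n - S n, ⟨fun n => ?_, fun n => ?_, hSo⟩, fun P hP => funext fun n => ?_⟩
  · exact (degree_sub_le _ _).trans (max_le (degree_X_pow_le n) (hS n).le)
  · simp [coeff_eq_zero_of_degree_lt (hS n)]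
  -- The leading terms cancel, so the difference has degree less than `n` and is orthogonal to
  -- itself.
  · refine sub_eq_zero.1 (eq_zero_of_orthogonal hW (n := n) ?_ fun Q hQ => ?_)
    · rw [degree_lt_iff_coeff_zero]
      intro m hm
      rcases hm.eq_or_lt with rfl | hm
      · simp [hP.coeff_self, coeff_eq_zero_of_degree_lt (hS n)]
      · simp [coeff_eq_zero_of_degree_lt ((hP.degree_le n).trans_lt (Nat.cast_lt.2 hm)),
          coeff_eq_zero_of_degree_lt ((hS n).trans (Nat.cast_lt.2 hm)), coeff_X_pow, hm.ne']
    · rw [pairing_sub_left hW, hP.orthogonal n Q hQ, hSo n Q hQ, sub_self]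

end Orthogonal

/-! ### Orthonormalization and the matrices `γₙ`, `βₙ` -/

section MonicMOPRL

variable {W : ℝ → Mat N} {P : ℕ → (Mat N)[X]} {κ : ℕ → Mat N}

theorem IsMonicMOPRL.orthogonal_left (hP : IsMonicMOPRL a b W P) (hW : IsWeight a b W) {n : ℕ}
    {Q : (Mat N)[X]} (hQ : Q.degree < n) : pairing a b W Q (P n) = 0 := by
  rw [← pairing_conjTranspose hW, hP.orthogonal n Q hQ, Matrix.conjTranspose_zero]

theorem IsMonicMOPRL.pairing_of_ne (hP : IsMonicMOPRL a b W P) (hW : IsWeight a b W) {n m : ℕ}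
    (h : n ≠ m) : pairing a b W (P n) (P m) = 0 := by
  rcases h.lt_or_gt with h | h
  · exact hP.orthogonal_left hW ((hP.degree_le n).trans_lt (Nat.cast_lt.2 h))
  · exact hP.orthogonal n _ ((hP.degree_le m).trans_lt (Nat.cast_lt.2 h))

theorem degree_prev_lt (hP : IsMonicMOPRL a b W P) (n : ℕ) : (prev P n).degree < n := by
  cases n with
  | zero => simp [prev]
  | succ n => exact degree_lt_succ_of_le (hP.degree_le n)

open scoped MatrixOrder in
-- Take `B` with `B* B = H⁻¹`; then `B* (B H) = 1`, and a one-sided inverse of a square matrix is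
-- two-sided.
theorem exists_mul_mul_conjTranspose_eq_one {H : Mat N} (hH : H.PosDef) :
    ∃ B : Mat N, B * H * B.conjTranspose = 1 := by
  obtain ⟨B, hB⟩ := CStarAlgebra.nonneg_iff_eq_star_mul_self.1 hH.inv.posSemidef.nonneg
  rw [Matrix.star_eq_conjTranspose] at hB
  have hunit : IsUnit H.det := (Matrix.isUnit_iff_isUnit_det _).1 hH.isUnit
  have h : B.conjTranspose * (B * H) = 1 := by
    rw [← Matrix.mul_assoc, ← hB, Matrix.nonsing_inv_mul _ hunit]
  exact ⟨B, mul_eq_one_comm.1 h⟩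

theorem exists_isNormalizing (hW : IsWeight a b W) (hP : IsMonicMOPRL a b W P) :
    ∃ κ : ℕ → Mat N, IsNormalizing a b W P κ := by
  choose κ hκ using fun n =>
    exists_mul_mul_conjTranspose_eq_one (pairing_self_posDef hW (hP.coeff_self n))
  refine ⟨κ, fun n m => ?_⟩
  rw [pairing_C_mul_left hW, pairing_C_mul_right hW, ← Matrix.mul_assoc]
  split_ifs with h
  · subst h
    exact hκ n
  · rw [hP.pairing_of_ne hW h, Matrix.mul_zero, Matrix.zero_mul]

theorem gam_conjTranspose (κ : ℕ → Mat N) (n : ℕ) : (gam κ n).conjTranspose = gam κ n := by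
  simp [gam]

theorem prev_gam_conjTranspose (κ : ℕ → Mat N) (n : ℕ) :
    (prev (gam κ) n).conjTranspose = prev (gam κ) n := by
  cases n with
  | zero => simp [prev]
  | succ n => exact gam_conjTranspose κ n

/-- Thus `γₙ` is the inverse of `(Pₙ, Pₙ)_W`, whatever the choice of `κₙ`. -/
theorem IsNormalizing.pairing_mul_gam (hκ : IsNormalizing a b W P κ) (hW : IsWeight a b W)
    (n : ℕ) : pairing a b W (P n) (P n) * gam κ n = 1 := by
  have h := hκ n n
  rw [pairing_C_mul_left hW, pairing_C_mul_right hW, if_pos rfl] at h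
  rw [gam, ← Matrix.mul_assoc]
  exact mul_eq_one_comm.1 h

theorem IsNormalizing.gam_mul_pairing (hκ : IsNormalizing a b W P κ) (hW : IsWeight a b W)
    (n : ℕ) : gam κ n * pairing a b W (P n) (P n) = 1 :=
  mul_eq_one_comm.1 (hκ.pairing_mul_gam hW n)

theorem IsNormalizing.gam_mul_beta (hκ : IsNormalizing a b W P κ) (hW : IsWeight a b W)
    (n : ℕ) : gam κ n * beta κ n = prev (gam κ) n := by
  rw [beta, ← Matrix.mul_assoc, Matrix.mul_nonsing_inv, Matrix.one_mul]
  exact (Matrix.isUnit_iff_isUnit_det _).1 (IsUnit.of_mul_eq_one _ (hκ.gam_mul_pairing hW n))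

theorem IsNormalizing.beta_eq (hκ : IsNormalizing a b W P κ) (hW : IsWeight a b W)
    (n : ℕ) : beta κ n = pairing a b W (P n) (P n) * prev (gam κ) n := by
  rw [← hκ.gam_mul_beta hW, ← Matrix.mul_assoc, hκ.pairing_mul_gam hW, Matrix.one_mul]

/-! ### The three-term recurrence -/

/-- Monicity cancels the coefficient of `xⁿ⁺¹`, and `αₙ` is exactly what cancels that of `xⁿ`. -/
theorem IsMonicMOPRL.degree_X_mul_sub_lt (hP : IsMonicMOPRL a b W P) (n : ℕ) :
    (X * P n - P (n + 1) - C (alpha P n) * P n).degree < (n : WithBot ℕ) := by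
  rw [degree_lt_iff_coeff_zero]
  intro m hm
  have hdeg : ∀ k l, k < l → (P k).coeff l = 0 := fun k l h =>
    coeff_eq_zero_of_degree_lt ((hP.degree_le k).trans_lt (Nat.cast_lt.2 h))
  rcases hm.eq_or_lt with rfl | hm
  · cases n with
    | zero => simp [alpha, subleading, prev, hP.coeff_self]
    | succ n =>
      rw [coeff_sub, coeff_sub, coeff_C_mul, coeff_X_mul, hP.coeff_self]
      simp [alpha, subleading, prev]
  · obtain ⟨k, rfl⟩ : ∃ k, m = k + 1 := ⟨m - 1, by omega⟩
    rcases (Nat.lt_succ_iff.1 hm).eq_or_lt with rfl | hk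
    · simp [coeff_X_mul, hP.coeff_self, hdeg n (n + 1) n.lt_succ_self]
    · simp [coeff_X_mul, hdeg n k hk, hdeg (n + 1) (k + 1) (by omega), hdeg n (k + 1) (by omega)]

theorem IsMonicMOPRL.pairing_X_mul_prev (hP : IsMonicMOPRL a b W P) (hW : IsWeight a b W)
    (n : ℕ) : pairing a b W (P (n + 1)) (X * P n) = pairing a b W (P (n + 1)) (P (n + 1)) := by
  have h := hP.orthogonal (n + 1) (X * P n - P (n + 1)) (by
    have hα : (C (alpha P n) * P n).degree < (n + 1 : ℕ) :=
      degree_lt_succ_of_le ((degree_C_mul_le _ _).trans (hP.degree_le n))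
    simpa using degree_add_lt
      ((hP.degree_X_mul_sub_lt n).trans (Nat.cast_lt.2 n.lt_succ_self)) hα)
  rw [← sub_add_cancel (X * P n) (P (n + 1)), pairing_add_right hW, h, zero_add]

/-- The difference of the two sides has degree less than `n`, so it suffices that it is orthogonal
to such degrees. Self-adjointness of `x` leaves only the component of `Q` along `Pₙ₋₁`, where `(Pₙ,
x Pₙ₋₁)_W = (Pₙ, Pₙ)_W = βₙ (Pₙ₋₁, Pₙ₋₁)_W`. -/
theorem IsMonicMOPRL.three_term (hP : IsMonicMOPRL a b W P) (hW : IsWeight a b W)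
    (hκ : IsNormalizing a b W P κ) (n : ℕ) :
    X * P n = P (n + 1) + C (alpha P n) * P n + C (beta κ n) * prev P n := by
  rw [← sub_eq_zero, ← sub_sub, ← sub_sub]
  refine eq_zero_of_orthogonal hW (n := n) (degree_sub_lt_of_lt (hP.degree_X_mul_sub_lt n)
    ((degree_C_mul_le _ _).trans_lt (degree_prev_lt hP n))) fun Q hQ => ?_
  rw [pairing_sub_left hW, pairing_sub_left hW, pairing_sub_left hW, pairing_C_mul_left hW,
    pairing_C_mul_left hW, pairing_X_mul, hP.orthogonal n Q hQ,
    hP.orthogonal (n + 1) Q (hQ.trans (Nat.cast_lt.2 n.lt_succ_self)), Matrix.mul_zero,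
    sub_zero, sub_zero]
  cases n with
  | zero =>
    have : Q = 0 := by simpa using hQ
    simp [this, pairing_zero_right]
  | succ n =>
    -- The index in the recurrence is now `n + 1`, so `P n` is the previous polynomial.
    obtain ⟨Q', hQ', hQe⟩ := exists_eq_add_C_mul hQ (hP.degree_le n) (hP.coeff_self n)
    have hX : (X * Q').degree < ((n + 1 : ℕ) : WithBot ℕ) := by
      rw [degree_lt_iff_coeff_zero] at hQ' ⊢
      intro m hm
      obtain ⟨k, rfl⟩ : ∃ k, m = k + 1 := ⟨m - 1, by omega⟩
      rw [coeff_X_mul, hQ' k (by omega)]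
    have hXC : X * (C (Q.coeff n) * P n) = C (Q.coeff n) * (X * P n) := by
      rw [← mul_assoc, X_mul_C, mul_assoc]
    have hg := hκ.gam_mul_pairing hW n
    rw [hQe, mul_add, pairing_add_right hW, pairing_add_right hW, hP.orthogonal _ _ hX, hXC,
      pairing_C_mul_right hW, hP.pairing_X_mul_prev hW]
    simp only [prev]
    rw [hP.orthogonal n Q' hQ', pairing_C_mul_right hW, zero_add, zero_add, hκ.beta_eq hW]
    simp only [prev]
    rw [Matrix.mul_assoc _ (gam κ n), ← Matrix.mul_assoc (gam κ n), hg, Matrix.one_mul, sub_self]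

/-- `αₙ (Pₙ, Pₙ)_W = (x Pₙ, Pₙ)_W` is Hermitian; multiply by `γₙ` on both sides. This makes the `αₙ`
terms cancel in the Christoffel–Darboux formula. -/
theorem IsMonicMOPRL.alpha_conjTranspose_mul_gam (hP : IsMonicMOPRL a b W P)
    (hW : IsWeight a b W) (hκ : IsNormalizing a b W P κ) (n : ℕ) :
    (alpha P n).conjTranspose * gam κ n = gam κ n * alpha P n := by
  set H := pairing a b W (P n) (P n) with hH
  have h1 : pairing a b W (X * P n) (P n) = alpha P n * H := by
    rw [hP.three_term hW hκ n, pairing_add_left hW, pairing_add_left hW,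
      hP.pairing_of_ne hW n.succ_ne_self, pairing_C_mul_left hW, pairing_C_mul_left hW,
      hP.orthogonal_left hW (degree_prev_lt hP n), Matrix.mul_zero, zero_add, add_zero]
  have h2 : H * (alpha P n).conjTranspose = alpha P n * H := by
    rw [← h1, pairing_X_mul, ← pairing_conjTranspose hW, h1, Matrix.conjTranspose_mul,
      hH, pairing_conjTranspose hW]
  calc (alpha P n).conjTranspose * gam κ n
      = gam κ n * (H * (alpha P n).conjTranspose) * gam κ n := by
        rw [← Matrix.mul_assoc, hκ.gam_mul_pairing hW, Matrix.one_mul]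
    _ = gam κ n * alpha P n := by
        rw [h2, ← Matrix.mul_assoc, Matrix.mul_assoc, hκ.pairing_mul_gam hW, Matrix.mul_one]

/-! ### The Christoffel–Darboux kernel -/

/-- The polynomial `Q` of degree less than `n` with `(R, Q)_W = R(z)` for each `R` of degree less
than `n`. -/
noncomputable def reproducing (P : ℕ → (Mat N)[X]) (κ : ℕ → Mat N) (z : ℂ) (n : ℕ) : (Mat N)[X] :=
  ∑ k ∈ Finset.range n, C (gam κ k * value (P k) z).conjTranspose * P k

theorem reproducing_succ (z : ℂ) (n : ℕ) : reproducing P κ z (n + 1) =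
    reproducing P κ z n + C (gam κ n * value (P n) z).conjTranspose * P n :=
  Finset.sum_range_succ _ n

theorem degree_reproducing_lt (hP : IsMonicMOPRL a b W P) (z : ℂ) (n : ℕ) :
    (reproducing P κ z n).degree < n := by
  induction n with
  | zero => simp [reproducing]
  | succ n ih =>
    rw [reproducing_succ]
    exact degree_add_lt (ih.trans (Nat.cast_lt.2 n.lt_succ_self))
      (degree_lt_succ_of_le ((degree_C_mul_le _ _).trans (hP.degree_le n)))

/-- Splitting off the multiple `c Pₙ` of `R`, the cross terms vanish, and `(Pₙ, Pₙ)_W γₙ = 1` turns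
the new diagonal term into `c Pₙ(z)`. -/
theorem pairing_reproducing (hP : IsMonicMOPRL a b W P) (hW : IsWeight a b W)
    (hκ : IsNormalizing a b W P κ) (z : ℂ) {n : ℕ} {R : (Mat N)[X]} (hR : R.degree < n) :
    pairing a b W R (reproducing P κ z n) = value R z := by
  induction n generalizing R with
  | zero =>
    have : R = 0 := by simpa using hR
    simp [this, reproducing, pairing_zero_right]
  | succ n ih =>
    obtain ⟨R', hR', hRe⟩ := exists_eq_add_C_mul hR (hP.degree_le n) (hP.coeff_self n)
    rw [hRe, reproducing_succ, pairing_add_left hW, pairing_add_right hW, pairing_add_right hW,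
      ih hR', pairing_C_mul_right hW, hP.orthogonal_left hW hR', pairing_C_mul_left hW,
      pairing_C_mul_left hW, hP.orthogonal n _ (degree_reproducing_lt hP z n),
      pairing_C_mul_right hW, Matrix.conjTranspose_conjTranspose,
      ← Matrix.mul_assoc (pairing _ _ _ _ _),
      hκ.pairing_mul_gam hW]
    simp

theorem value_three_term (hP : IsMonicMOPRL a b W P) (hW : IsWeight a b W)
    (hκ : IsNormalizing a b W P κ) (n : ℕ) (z : ℂ) :
    z • value (P n) z =
      value (P (n + 1)) z + alpha P n * value (P n) z + beta κ n * value (prev P n) z := by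
  simpa using congrArg (value · z) (hP.three_term hW hκ n)

/-- The Christoffel–Darboux formula. -/
theorem sub_smul_reproducing (hP : IsMonicMOPRL a b W P) (hW : IsWeight a b W)
    (hκ : IsNormalizing a b W P κ) (z : ℂ) (n : ℕ) (t : ℝ) :
    ((t : ℂ) - z) • (value (reproducing P κ z n) t).conjTranspose =
      (value (P n) t).conjTranspose * (prev (gam κ) n * value (prev P n) z) -
        (value (prev P n) t).conjTranspose * (prev (gam κ) n * value (P n) z) := by
  induction n with
  | zero => simp [reproducing, prev]
  | succ n ih =>
    rw [reproducing_succ, value_add, value_C_mul, Matrix.conjTranspose_add, smul_add, ih,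
      Matrix.conjTranspose_mul, Matrix.conjTranspose_conjTranspose, sub_smul]
    have hβ := hκ.gam_mul_beta hW n
    have hβ' : (beta κ n).conjTranspose * gam κ n = prev (gam κ) n := by
      rw [← prev_gam_conjTranspose, ← hβ, Matrix.conjTranspose_mul, gam_conjTranspose]
    have ht : (t : ℂ) • (value (P n) t).conjTranspose = (value (P (n + 1)) t).conjTranspose +
        (value (P n) t).conjTranspose * (alpha P n).conjTranspose +
        (value (prev P n) t).conjTranspose * (beta κ n).conjTranspose := by
      have := congrArg Matrix.conjTranspose (value_three_term hP hW hκ n t)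
      simpa only [Matrix.conjTranspose_add, Matrix.conjTranspose_smul, Matrix.conjTranspose_mul,
        RCLike.star_def, Complex.conj_ofReal] using this
    -- The recurrence is applied at `t`, in adjoint form, here and at `z` in `e2`. On subtraction
    -- the `αₙ` terms cancel, and the terms with `prev (gam κ) n` cancel against the induction
    -- hypothesis.
    have e1 : (t : ℂ) • ((value (P n) t).conjTranspose * (gam κ n * value (P n) z)) =
        (value (P (n + 1)) t).conjTranspose * (gam κ n * value (P n) z) +
        (value (P n) t).conjTranspose * (gam κ n * alpha P n * value (P n) z) +
        (value (prev P n) t).conjTranspose * (prev (gam κ) n * value (P n) z) := by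
      rw [← Matrix.smul_mul, ht, ← hβ', ← hP.alpha_conjTranspose_mul_gam hW hκ]
      simp only [Matrix.add_mul, Matrix.mul_assoc]
    have e2 : z • ((value (P n) t).conjTranspose * (gam κ n * value (P n) z)) =
        (value (P n) t).conjTranspose * (gam κ n * value (P (n + 1)) z) +
        (value (P n) t).conjTranspose * (gam κ n * alpha P n * value (P n) z) +
        (value (P n) t).conjTranspose * (prev (gam κ) n * value (prev P n) z) := by
      rw [← Matrix.mul_smul, ← Matrix.mul_smul, value_three_term hP hW hκ n z, ← hβ]
      simp only [Matrix.mul_add, Matrix.mul_assoc]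
    rw [e1, e2]
    simp only [prev]
    abel

/-! ### The lowering and raising relations -/

theorem degree_derivative_lt_of_lt_succ {R : (Mat N)[X]} {n : ℕ} (hR : R.degree < (n + 1 : ℕ)) :
    (derivative R).degree < n := by
  rw [degree_lt_iff_coeff_zero] at hR ⊢
  intro m hm
  rw [coeff_derivative, hR (m + 1) (by omega), zero_mul]

/-- The adjoint moves `γₙ` to the right, where it meets `βₙ` and gives `γₙ₋₁`; the integral term is
unchanged by Hermitian symmetry of `W` and `W'`. -/
theorem starFun_ladderA (hW : IsWeight a b W) (n : ℕ) {z : ℂ} (hz : z ∉ closedInterval a b) :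
    starFun (ladderA a b W P κ n) z = -(ladderTerm a b W (P n) (P n) z * gam κ n) := by
  rw [starFun, ladderA, Matrix.conjTranspose_neg, Matrix.conjTranspose_mul,
    ladderTerm_conjTranspose hW _ _ hz, gam_conjTranspose]

theorem lowering (hW : IsWeight a b W) (hP : IsMonicMOPRL a b W P)
    (hκ : IsNormalizing a b W P κ) (n : ℕ) {z : ℂ} (hz : z ∉ closedInterval a b) :
    value (derivative (P n)) z = -ladderB a b W P κ n z * value (P n) z +
      starFun (ladderA a b W P κ n) z * beta κ n * value (prev P n) z := by
  -- This kills the term with the derivative of the kernel in the integration by parts.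
  have horth : pairing a b W (P n) (derivative (reproducing P κ z n)) = 0 :=
    hP.orthogonal n _ (degree_derivative_lt_of_lt_succ
      ((degree_reproducing_lt hP z n).trans (Nat.cast_lt.2 n.lt_succ_self)))
  rw [← pairing_reproducing hP hW hκ z
      (degree_derivative_lt_of_lt_succ (degree_lt_succ_of_le (hP.degree_le n))),
    pairing_derivative_eq_ladderTerm hW hz horth (sub_smul_reproducing hP hW hκ z n),
    starFun_ladderA hW n hz, ← hκ.gam_mul_beta hW, ladderB, ← hκ.gam_mul_beta hW]
  noncomm_ring

theorem raising (hW : IsWeight a b W) (hP : IsMonicMOPRL a b W P)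
    (hκ : IsNormalizing a b W P κ) (n : ℕ) {z : ℂ} (hz : z ∉ closedInterval a b) :
    value (derivative (P n)) z =
      (starFun (ladderA a b W P κ n) z * (z • (1 : Mat N) - alpha P n) - ladderB a b W P κ n z) *
        value (P n) z - starFun (ladderA a b W P κ n) z * value (P (n + 1)) z := by
  have h : beta κ n * value (prev P n) z =
      (z • (1 : Mat N) - alpha P n) * value (P n) z - value (P (n + 1)) z := by
    rw [Matrix.sub_mul, Matrix.smul_mul, Matrix.one_mul, value_three_term hP hW hκ n z]
    abel
  rw [lowering hW hP hκ n hz, Matrix.mul_assoc, h]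
  noncomm_ring

end MonicMOPRL

end MOPRL

theorem mainTheorem11 {N : ℕ} {a b : EReal} {W : ℝ → MOPRL.Mat N} (hW : MOPRL.IsWeight a b W) :
    (∃! P : ℕ → (MOPRL.Mat N)[X], MOPRL.IsMonicMOPRL a b W P) ∧
    ∀ P : ℕ → (MOPRL.Mat N)[X], MOPRL.IsMonicMOPRL a b W P →
      (∃ κ : ℕ → MOPRL.Mat N, MOPRL.IsNormalizing a b W P κ) ∧
      ∀ κ : ℕ → MOPRL.Mat N, MOPRL.IsNormalizing a b W P κ →
        (∀ n : ℕ, X * P n =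
          P (n + 1) + C (MOPRL.alpha P n) * P n + C (MOPRL.beta κ n) * MOPRL.prev P n) ∧
        ∀ (n : ℕ) (z : ℂ), z ∉ MOPRL.closedInterval a b →
          MOPRL.LadderTermExists a b W (P n) (P n) z ∧
          MOPRL.LadderTermExists a b W (P n) (MOPRL.prev P n) z ∧
          MOPRL.value (derivative (P n)) z =
            -MOPRL.ladderB a b W P κ n z * MOPRL.value (P n) z +
              MOPRL.starFun (MOPRL.ladderA a b W P κ n) z * MOPRL.beta κ n *
                MOPRL.value (MOPRL.prev P n) z ∧
          MOPRL.value (derivative (P n)) z =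
            (MOPRL.starFun (MOPRL.ladderA a b W P κ n) z *
                (z • (1 : MOPRL.Mat N) - MOPRL.alpha P n) - MOPRL.ladderB a b W P κ n z) *
                MOPRL.value (P n) z -
              MOPRL.starFun (MOPRL.ladderA a b W P κ n) z * MOPRL.value (P (n + 1)) z := by
  refine ⟨MOPRL.existsUnique_isMonicMOPRL hW, fun P hP => ⟨MOPRL.exists_isNormalizing hW hP,
    fun κ hκ => ⟨hP.three_term hW hκ, fun n z hz => ⟨MOPRL.ladderTermExists hW _ _ hz,
      MOPRL.ladderTermExists hW _ _ hz, MOPRL.lowering hW hP hκ n hz,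
      MOPRL.raising hW hP hκ n hz⟩⟩⟩⟩
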